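/- Let $V\in C_c^\infty(\mathbb R^3)$ be real valued with $V\le 0$, and let $H=-\Delta+V$ be the Schrödinger operator on $L^2(\mathbb R^3)$ with domain $H^2(\mathbb R^3)$. Assume that $0$ is not an eigenvalue of $H$ and that the discrete spectrum $\sigma_d(H)$ (the isolated points of the spectrum that are eigenvalues of finite multiplicity) consists of a single eigenvalue $E<0$, which is non-degenerate. Let $p_E$ be the orthogonal projection onto $\ker(H-E)$, let $P_{\rm disc}$ be the spectral projection to the discrete spectrum, and let $P_{\rm ess}=1-P_{\rm disc}$. Let $\chi$ be a (complex valued) Schwartz function on $\mathbb R^3$ which is equal to a constant $c\neq 0$ in a neighbourhood of the origin. Let $\kappa:(0,\infty)\to\mathbb C$ be a $C^3$ function, not identically zero, such that $\sup_{\omega\ge 1}\omega^n|\kappa(\omega)|<\infty$ for all $n\in\mathbb N_0$, and such that either there are $k_1,k_2>0$ and $p>2$ with $|\kappa^{(j)}(\omega)|\le k_2\,\omega^{p-j}$ for all $0<\omega<k_1$ and $0\le j\le 3$, or $\kappa(\omega)=\omega^{1/2}\tilde\kappa(\omega)$ or $\kappa(\omega)=\omega^{-1/2}\tilde\kappa(\omega)$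 for all $\omega>0$ with some $\tilde\kappa\in C^3([0,\infty))$ whose derivatives of order $0,\dots,3$ are bounded. For $\alpha>0$, $\omega>0$ and $\Sigma\in\mathbb S^2$ let $G(\omega,\Sigma)$ be the operator of multiplication by $x\mapsto\kappa(\omega)e^{i\omega\Sigma\cdot x}\chi(\alpha x)$ on $L^2(\mathbb R^3)$. For $\epsilon,\beta>0$ set \[ F^{(1)}_\epsilon=\int_0^\infty\!\!\int_{\mathbb S^2}\frac{\omega^2}{e^{\beta\omega}-1}\,G(\omega,\Sigma)\frac{\epsilon P_{\rm ess}}{(H-E-\omega)^2+\epsilon^2}G(\omega,\Sigma)^*\,d\Sigma\,d\omega, \] \[ F^{(2)}_\epsilon=\int_0^\infty\!\!\int_{\mathbb S^2}\frac{\omega^2}{1-e^{-\beta\omega}}\,G(\omega,\Sigma)^*\frac{\epsilon P_{\rm ess}}{(H-E+\omega)^2+\epsilon^2}G(\omega,\Sigma)\,d\Sigma\,d\omega . \] Then for every $\epsilon>0$ there exist $\alpha>0$ and $\gamma>0$, independent of $\beta$, such that for all $\beta>0$ both integrals converge (as Bochner integrals in operator norm), \[ p_E F^{(2)}_\epsilon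 p_E\ \ge\ \gamma\,p_E ,\qquad p_E F^{(2)}_\epsilon p_E=\langle\phi_E,F^{(2)}_\epsilon\phi_E\rangle\,p_E\ \text{ for every normalized eigenvector } \phi_E \text{ of } H \text{ to the eigenvalue } E, \] and the Fermi Golden Rule condition holds with the same constant $\gamma$ for all $\beta>0$: for every $E'\in\sigma_d(H)$ (that is, for $E'=E$), \[ p_{E'}\bigl(F^{(1)}_\epsilon+F^{(2)}_\epsilon\bigr)p_{E'}\ \ge\ \gamma\,p_{E'} . \] -/

import Mathlib

open MeasureTheory Set Filter Topology
open scoped ENNReal SchwartzMap InnerProductSpace Laplacian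

noncomputable section

namespace ThermalIonization

/-- Physical space `ℝ³`. -/
abbrev Space : Type := EuclideanSpace ℝ (Fin 3)

/-- The unit sphere `𝕊²` of directions. -/
abbrev Dir : Type := Metric.sphere (0 : Space) 1

/-- The particle Hilbert space `L²(ℝ³; ℂ)`. -/
abbrev Hil : Type := Lp ℂ 2 (volume : Measure Space)

/-- The bounded operators on `L²(ℝ³; ℂ)`. The relation `≤` between them is the usual order
of quadratic forms. -/
abbrev BddOp : Type := Hil →L[ℂ] Hil

/-! ### The Schrödinger operator -/

/-- An `L²` function, viewed as a tempered distribution. -/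
def distr : Hil →ₗ[ℂ] 𝓢'(Space, ℂ) :=
  (Lp.toTemperedDistributionCLM ℂ (volume : Measure Space) 2).toLinearMap

theorem distr_injective : Function.Injective distr :=
  LinearMap.ker_eq_bot.mp (Lp.ker_toTemperedDistributionCLM_eq_bot (F := ℂ)
    (μ := (volume : Measure Space)) (p := 2))

/-- The Sobolev space `H²(ℝ³)`, as a subspace of `L²(ℝ³)`. -/
def sobolevTwo : Submodule ℂ Hil where
  carrier := {f | TemperedDistribution.MemSobolev 2 2 (distr f)}
  add_mem' := by
    intro f g hf hg
    change TemperedDistribution.MemSobolev 2 2 (distr (f + g))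
    rw [map_add]
    exact TemperedDistribution.MemSobolev.add hf hg
  zero_mem' := by
    change TemperedDistribution.MemSobolev 2 2 (distr 0)
    rw [map_zero]
    exact TemperedDistribution.memSobolev_fun_zero Space ℂ 2 2
  smul_mem' := by
    intro c f hf
    change TemperedDistribution.MemSobolev 2 2 (distr (c • f))
    rw [map_smul]
    exact TemperedDistribution.MemSobolev.smul c hf

theorem exists_laplacian (f : sobolevTwo) : ∃ g : Hil, distr g = Δ (distr f) := by
  have h := TemperedDistribution.MemSobolev.laplacian f.2
  rw [sub_self, TemperedDistribution.memSobolev_zero_iff] at h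
  obtain ⟨g, hg⟩ := h
  exact ⟨g, hg.symm⟩

/-- The distributional Laplacian `Δ : H²(ℝ³) → L²(ℝ³)`. -/
def lapl : sobolevTwo →ₗ[ℂ] Hil where
  toFun f := (exists_laplacian f).choose
  map_add' f g := by
    apply distr_injective
    rw [map_add, (exists_laplacian f).choose_spec, (exists_laplacian g).choose_spec,
      (exists_laplacian (f + g)).choose_spec, Submodule.coe_add, map_add]
    simp only [← TemperedDistribution.laplacianCLM_apply, map_add]
  map_smul' c f := by
    apply distr_injective
    rw [map_smul, (exists_laplacian f).choose_spec, (exists_laplacian (c • f)).choose_spec,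
      Submodule.coe_smul, map_smul]
    simp only [← TemperedDistribution.laplacianCLM_apply, map_smul, RingHom.id_apply]

theorem distr_lapl (f : sobolevTwo) : distr (lapl f) = Δ (distr f) :=
  (exists_laplacian f).choose_spec

open Classical in
/-- The operator of multiplication by an essentially bounded measurable function `m`
(`0` by convention for all other `m`). -/
def mulOp (m : Space → ℂ) : BddOp :=
  if h : MemLp m ∞ volume then
    (ContinuousLinearMap.mul ℂ ℂ).holderL volume ∞ 2 2 h.toLp
  else 0

theorem mulOp_coeFn {m : Space → ℂ} (h : MemLp m ∞ volume) (f : Hil) :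
    mulOp m f =ᵐ[volume] fun x => m x * f x := by
  rw [mulOp, dif_pos h]
  filter_upwards [(ContinuousLinearMap.mul ℂ ℂ).coeFn_holder (r := 2) (h.toLp) f, h.coeFn_toLp]
    with x hx hm
  refine hx.trans ?_
  rw [hm]
  rfl

/-- The Schrödinger operator `-Δ + V` in `L²(ℝ³)` with domain `H²(ℝ³)`. -/
def schrodinger (V : Space → ℝ) : Hil →ₗ.[ℂ] Hil where
  domain := sobolevTwo
  toFun := -lapl + (mulOp (fun x => (V x : ℂ))).toLinearMap ∘ₗ sobolevTwo.subtype

/-! ### Spectral notions for an operator `A` in `L²(ℝ³)` -/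

/-- The operator `A - z`, with the same domain as `A`. -/
def shift (A : Hil →ₗ.[ℂ] Hil) (z : ℂ) : Hil →ₗ.[ℂ] Hil where
  domain := A.domain
  toFun := A.toFun - z • A.domain.subtype

/-- The resolvent set of `A`: the `z` for which `A - z` has an everywhere defined bounded
inverse `R`. -/
def resolventSet (A : Hil →ₗ.[ℂ] Hil) : Set ℂ :=
  {z | ∃ R : BddOp, ∀ f g : Hil, R g = f ↔ ∃ hf : f ∈ (shift A z).domain, shift A z ⟨f, hf⟩ = g}

/-- The eigenspace `ker (A - z)`. -/
def eigenspace (A : Hil →ₗ.[ℂ] Hil) (z : ℂ) : Submodule ℂ Hil :=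
  (LinearMap.ker (shift A z).toFun).map (shift A z).domain.subtype

/-- The discrete spectrum (of a self-adjoint `A`): the isolated points of the spectrum which are
eigenvalues of finite multiplicity. -/
def discreteSpectrum (A : Hil →ₗ.[ℂ] Hil) : Set ℝ :=
  {E | eigenspace A E ≠ ⊥ ∧ FiniteDimensional ℂ (eigenspace A E) ∧
    ∃ δ > 0, ∀ z : ℂ, z ≠ E → ‖z - E‖ < δ → z ∈ resolventSet A}

/-- The spectral projection `p_E` of `A` corresponding to the eigenvalue `E`: the orthogonal
projection onto the (closed) eigenspace. -/
def eigenProj (A : Hil →ₗ.[ℂ] Hil) (E : ℝ) : BddOp :=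
  (eigenspace A E).topologicalClosure.starProjection

/-- The spectral projection `P_disc` to the discrete spectrum of `A`: the orthogonal projection
onto the closed span of all the eigenspaces that belong to it. -/
def discProj (A : Hil →ₗ.[ℂ] Hil) : BddOp :=
  (⨆ E ∈ discreteSpectrum A, eigenspace A (E : ℂ)).topologicalClosure.starProjection

/-- The spectral projection `P_ess = 1 - P_disc` to the essential spectrum of `A`. -/
def essProj (A : Hil →ₗ.[ℂ] Hil) : BddOp := 1 - discProj A

/-- `B` is the everywhere defined bounded inverse of `(A - e)² + ε²`. -/
def IsInverseSqAdd (A : Hil →ₗ.[ℂ] Hil) (e ε : ℝ) (B : BddOp) : Prop :=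
  ∀ f g : Hil, B g = f ↔
    ∃ (hf : f ∈ (shift A e).domain) (hf' : shift A e ⟨f, hf⟩ ∈ (shift A e).domain),
      shift A e ⟨shift A e ⟨f, hf⟩, hf'⟩ + ((ε ^ 2 : ℝ) : ℂ) • f = g

open Classical in
/-- The bounded operator `((A - e)² + ε²)⁻¹` (`0` by convention if there is no such inverse). -/
def inverseSqAdd (A : Hil →ₗ.[ℂ] Hil) (e ε : ℝ) : BddOp :=
  if h : ∃ B, IsInverseSqAdd A e ε B then h.choose else 0

/-- The operator `ε P_ess / ((A - e)² + ε²)`. -/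
def lorentz (A : Hil →ₗ.[ℂ] Hil) (e ε : ℝ) : BddOp :=
  (ε : ℂ) • (essProj A ∘L inverseSqAdd A e ε)

/-! ### The level shift operators and the Fermi Golden Rule condition -/

/-- The measure `dω dΣ` on `(0, ∞) × 𝕊²`, where `dΣ` is the surface measure of `𝕊²`. -/
def modeMeasure : Measure (ℝ × Dir) :=
  ((volume : Measure ℝ).restrict (Ioi 0)).prod (volume : Measure Space).toSphere

/-- The integrand of `F⁽¹⁾_ε` at `(ω, Σ)`. -/
def integrandOne (A : Hil →ₗ.[ℂ] Hil) (G : ℝ × Dir → BddOp) (β ε E : ℝ) (k : ℝ × Dir) : BddOp :=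
  ((k.1 ^ 2 / (Real.exp (β * k.1) - 1) : ℝ) : ℂ) •
    (G k ∘L lorentz A (E + k.1) ε ∘L (G k).adjoint)

/-- The integrand of `F⁽²⁾_ε` at `(ω, Σ)`. -/
def integrandTwo (A : Hil →ₗ.[ℂ] Hil) (G : ℝ × Dir → BddOp) (β ε E : ℝ) (k : ℝ × Dir) : BddOp :=
  ((k.1 ^ 2 / (1 - Real.exp (-(β * k.1))) : ℝ) : ℂ) •
    ((G k).adjoint ∘L lorentz A (E - k.1) ε ∘L G k)

/-- `F⁽¹⁾_ε = ∫ ω² / (e^{βω} - 1) G(ω,Σ) (ε P_ess / ((A - E - ω)² + ε²)) G(ω,Σ)^* dΣ dω`. -/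
def levelShiftOne (A : Hil →ₗ.[ℂ] Hil) (G : ℝ × Dir → BddOp) (β ε E : ℝ) : BddOp :=
  ∫ k, integrandOne A G β ε E k ∂modeMeasure

/-- `F⁽²⁾_ε = ∫ ω² / (1 - e^{-βω}) G(ω,Σ)^* (ε P_ess / ((A - E + ω)² + ε²)) G(ω,Σ) dΣ dω`. -/
def levelShiftTwo (A : Hil →ₗ.[ℂ] Hil) (G : ℝ × Dir → BddOp) (β ε E : ℝ) : BddOp :=
  ∫ k, integrandTwo A G β ε E k ∂modeMeasure

/-- The Fermi Golden Rule condition with constant `γ` at inverse temperature `β`: for every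
`E` in the discrete spectrum, `F⁽¹⁾_ε` and `F⁽²⁾_ε` exist as norm convergent integrals and
`p_E (F⁽¹⁾_ε + F⁽²⁾_ε) p_E ≥ γ p_E`. -/
def FermiGoldenRule (A : Hil →ₗ.[ℂ] Hil) (G : ℝ × Dir → BddOp) (β ε γ : ℝ) : Prop :=
  0 < γ ∧ ∀ E ∈ discreteSpectrum A,
    Integrable (integrandOne A G β ε E) modeMeasure ∧
    Integrable (integrandTwo A G β ε E) modeMeasure ∧
    (γ : ℂ) • eigenProj A E ≤
      eigenProj A E ∘L (levelShiftOne A G β ε E + levelShiftTwo A G β ε E) ∘L eigenProj A E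

/-! ### The coupling -/

/-- The function `x ↦ κ(ω) e^{i ω Σ·x} χ(α x)`. -/
def couplingFun (κ : ℝ → ℂ) (χ : 𝓢(Space, ℂ)) (α : ℝ) (k : ℝ × Dir) (x : Space) : ℂ :=
  κ k.1 * Complex.exp (Complex.I * ((k.1 * ⟪(k.2 : Space), x⟫_ℝ : ℝ) : ℂ)) * χ (α • x)

/-- `G(ω, Σ)`: the multiplication operator by `x ↦ κ(ω) e^{i ω Σ·x} χ(α x)`. -/
def coupling (κ : ℝ → ℂ) (χ : 𝓢(Space, ℂ)) (α : ℝ) (k : ℝ × Dir) : BddOp :=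
  mulOp (couplingFun κ χ α k)

/-- Ultraviolet cutoff: `κ` decays faster than any polynomial. -/
def UVCutoff (κ : ℝ → ℂ) : Prop :=
  ∀ n : ℕ, ∃ C : ℝ, ∀ ω : ℝ, 1 ≤ ω → ω ^ n * ‖κ ω‖ ≤ C

/-- Infrared behavior: `κ` is `C³` on `(0, ∞)`, and either `|∂^j κ(ω)| ≤ k₂ ω^{p - j}` for
`0 < ω < k₁`, `j ≤ 3`, with some `p > 2`, or `κ(ω) = ω^{±1/2} κ'(ω)` where `κ'` is `C³` on
`[0, ∞)` with bounded derivatives. -/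
def InfraredBehavior (κ : ℝ → ℂ) : Prop :=
  ContDiffOn ℝ 3 κ (Ioi 0) ∧
    ((∃ k₁ k₂ p : ℝ, 0 < k₁ ∧ 0 < k₂ ∧ 2 < p ∧ ∀ j : ℕ, j ≤ 3 → ∀ ω : ℝ, 0 < ω → ω < k₁ →
        ‖iteratedDerivWithin j κ (Ioi 0) ω‖ ≤ k₂ * ω ^ (p - (j : ℝ))) ∨
      ∃ (s : ℝ) (κ' : ℝ → ℂ), (s = 1 / 2 ∨ s = -(1 / 2)) ∧ ContDiffOn ℝ 3 κ' (Ici 0) ∧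
        (∀ j : ℕ, j ≤ 3 → ∃ C : ℝ, ∀ ω : ℝ, 0 ≤ ω → ‖iteratedDerivWithin j κ' (Ici 0) ω‖ ≤ C) ∧
        ∀ ω : ℝ, 0 < ω → κ ω = ((ω ^ s : ℝ) : ℂ) * κ' ω)

end ThermalIonization

end

/-!
An isolated point of the spectrum has real resolvent points next to it, so the symmetric operator
`A` is self-adjoint. Its resolvents commute with `P_ess`, hence
`ε P_ess / ((A - e)² + ε²) = ε (S P_ess)^* (S P_ess)` with `S = (A - e - iε)⁻¹` is nonnegative, and
its quadratic form vanishes only on `ker P_ess`. Therefore `F⁽¹⁾_ε ≥ 0`, and since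
`1 / (1 - e^{-βω}) ≥ 1`, the operator `F⁽²⁾_ε` dominates its zero temperature part, which does not
depend on `β`. The expectation of that part in the eigenvector `φ` is the constant `γ`. It is
positive unless `G(ω,Σ) φ` is a multiple of `φ` for almost all `(ω,Σ)`. For small `α` the cutoff
`χ(α x)` equals `c` on a part of the support of `φ` of positive measure, so this would force a
plane wave to be constant on a set of positive measure, whereas its level sets are null.
-/

noncomputable section

namespace ThermalIonization

/-! ### Multiplication operators -/

theorem norm_mulOp_le {m : Space → ℂ} {C : ℝ} (hC : ∀ x, ‖m x‖ ≤ C) : ‖mulOp m‖ ≤ C := by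
  have hC0 : 0 ≤ C := (norm_nonneg _).trans (hC 0)
  by_cases hm : MemLp m ∞ volume
  · refine ContinuousLinearMap.opNorm_le_bound _ hC0 fun f => Lp.norm_le_mul_norm_of_ae_le_mul ?_
    filter_upwards [mulOp_coeFn hm f] with x hx
    rw [hx, norm_mul]
    gcongr
    exact hC x
  · rwa [mulOp, dif_neg hm, norm_zero]

theorem mulOp_sub {m n : Space → ℂ} (hm : MemLp m ∞ volume) (hn : MemLp n ∞ volume) :
    mulOp (m - n) = mulOp m - mulOp n := by
  refine ContinuousLinearMap.ext fun f => Lp.ext ?_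
  filter_upwards [mulOp_coeFn hm f, mulOp_coeFn hn f, mulOp_coeFn (hm.sub hn) f,
    Lp.coeFn_sub (mulOp m f) (mulOp n f)] with x hmx hnx hmnx hsub
  rw [hmnx, sub_apply, hsub, Pi.sub_apply, Pi.sub_apply, hmx, hnx, sub_mul]

theorem mulOp_const_smul {m : Space → ℂ} (hm : MemLp m ∞ volume) (c : ℂ) :
    mulOp (c • m) = c • mulOp m := by
  refine ContinuousLinearMap.ext fun f => Lp.ext ?_
  filter_upwards [mulOp_coeFn hm f, mulOp_coeFn (hm.const_smul c) f,
    Lp.coeFn_smul c (mulOp m f)] with x hmx hcmx hsmul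
  rw [hcmx, smul_apply, hsmul, Pi.smul_apply, Pi.smul_apply, hmx, smul_mul_assoc]

theorem inner_ofReal_mul_left (r : ℝ) (z w : ℂ) : ⟪r * z, w⟫_ℂ = ⟪z, r * w⟫_ℂ := by
  rw [← smul_eq_mul, ← smul_eq_mul, inner_smul_left, inner_smul_right, Complex.conj_ofReal]

theorem mulOp_ofReal_isSymmetric (m : Space → ℝ) :
    (mulOp fun x => (m x : ℂ)).toLinearMap.IsSymmetric := by
  intro f g
  change ⟪mulOp _ f, g⟫_ℂ = ⟪f, mulOp _ g⟫_ℂ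
  by_cases hm : MemLp (fun x => (m x : ℂ)) ∞ volume
  · rw [L2.inner_def, L2.inner_def]
    refine integral_congr_ae ?_
    filter_upwards [mulOp_coeFn hm f, mulOp_coeFn hm g] with x hf hg
    rw [hf, hg, inner_ofReal_mul_left]
  · simp only [mulOp, dif_neg hm, zero_apply, inner_zero_left, inner_zero_right]

theorem distr_mulOp {m : Space → ℂ} (hm : m.HasTemperateGrowth) (hb : MemLp m ∞ volume)
    (f : Hil) : distr (mulOp m f) = TemperedDistribution.smulLeftCLM ℂ m (distr f) := by
  refine Eq.trans (congrArg Lp.toTemperedDistribution (Lp.ext ?_))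
    (Lp.toTemperedDistribution_smul_eq (r := 2) hm hb f)
  filter_upwards [mulOp_coeFn hb f, Lp.coeFn_lpSMul (r := 2) (hb.toLp _) f, hb.coeFn_toLp]
    with x hmul hsmul hcoe
  rw [hmul, hsmul, Pi.smul_apply', hcoe, smul_eq_mul]

/-! ### Symmetry of the Schrödinger operator -/

theorem exists_temperate_weight {s : Space → ℂ} (hs : s.HasTemperateGrowth) :
    ∃ w : Space → ℂ, w.HasTemperateGrowth ∧ (∀ x, w x ≠ 0) ∧ MemLp w ∞ volume ∧
      MemLp (s * w) ∞ volume := by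
  obtain ⟨k, C, hC⟩ := hs.2 0
  let w : Space → ℂ := fun x => (((1 + ‖x‖ ^ 2) ^ (-k : ℝ) : ℝ) : ℂ)
  have hw : w.HasTemperateGrowth := by fun_prop
  have hnorm (x : Space) : ‖w x‖ = ((1 + ‖x‖ ^ 2) ^ k)⁻¹ := by
    rw [Complex.norm_real, Real.norm_of_nonneg (by positivity), Real.rpow_neg (by positivity),
      Real.rpow_natCast]
  refine ⟨w, hw, fun x => norm_ne_zero_iff.mp (by rw [hnorm]; positivity),
    memLp_top_of_bound hw.1.continuous.aestronglyMeasurable 1 (.of_forall fun x => ?_),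
    memLp_top_of_bound (hs.1.continuous.mul hw.1.continuous).aestronglyMeasurable (C * 2 ^ k)
      (.of_forall fun x => ?_)⟩
  · rw [hnorm]
    exact inv_le_one_of_one_le₀ (one_le_pow₀ (by nlinarith [sq_nonneg ‖x‖]))
  · have hsx : ‖s x‖ ≤ C * (1 + ‖x‖) ^ k := by simpa using hC x
    have hC0 : 0 ≤ C := by
      simpa using (norm_nonneg _).trans (hC 0)
    rw [Pi.mul_apply, norm_mul, hnorm, ← div_eq_mul_inv, div_le_iff₀ (by positivity), mul_assoc,
      ← mul_pow]
    refine hsx.trans ?_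
    gcongr
    nlinarith [sq_nonneg (‖x‖ - 1)]

theorem coeFn_ae_eq_mul_of_distr_eq {s : Space → ℂ} (hs : s.HasTemperateGrowth) {f g : Hil}
    (h : distr g = TemperedDistribution.smulLeftCLM ℂ s (distr f)) :
    g =ᵐ[volume] fun x => s x * f x := by
  -- A nowhere vanishing weight turns `s` into a bounded multiplier.
  obtain ⟨w, hw, hw0, hwb, hswb⟩ := exists_temperate_weight hs
  have hmul : mulOp w g = mulOp (s * w) f := distr_injective <| by
    rw [distr_mulOp hw hwb, distr_mulOp (hs.mul hw) hswb, h,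
      TemperedDistribution.smulLeftCLM_smulLeftCLM_apply hs hw]
  filter_upwards [mulOp_coeFn hwb g, mulOp_coeFn hswb f] with x hg hf
  refine mul_left_cancel₀ (hw0 x) ?_
  rw [← hg, hmul, hf, Pi.mul_apply, mul_comm (s x), mul_assoc]

open FourierTransform TemperedDistribution in
theorem fourier_lapl (f : sobolevTwo) :
    (𝓕 (lapl f) : Hil) =ᵐ[volume]
      fun ξ => ((-(2 * Real.pi) ^ 2 * ‖ξ‖ ^ 2 : ℝ) : ℂ) * (𝓕 (f : Hil) : Hil) ξ := by
  refine coeFn_ae_eq_mul_of_distr_eq (by fun_prop) ?_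
  have hfourier (g : Hil) : 𝓕 (distr g) = distr (𝓕 g) := Lp.fourier_toTemperedDistribution_eq g
  have hsymbol : (fun ξ : Space => ((-(2 * Real.pi) ^ 2 * ‖ξ‖ ^ 2 : ℝ) : ℂ)) =
      ((-(2 * Real.pi) ^ 2 : ℝ) : ℂ) • fun ξ : Space => ((‖ξ‖ ^ 2 : ℝ) : ℂ) := by
    ext ξ
    exact Complex.ofReal_mul _ _
  rw [← hfourier, distr_lapl, laplacian_eq_fourierMultiplierCLM, ← Complex.coe_smul,
    FourierTransform.fourier_smul, fourierMultiplierCLM_apply, fourier_fourierInv_eq, ← hfourier,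
    hsymbol, smulLeftCLM_smul (by fun_prop), smul_apply]

theorem inner_lapl_left (f g : sobolevTwo) : ⟪lapl f, (g : Hil)⟫_ℂ = ⟪(f : Hil), lapl g⟫_ℂ := by
  rw [← Lp.inner_fourier_eq, ← Lp.inner_fourier_eq (f : Hil), L2.inner_def, L2.inner_def]
  refine integral_congr_ae ?_
  filter_upwards [fourier_lapl f, fourier_lapl g] with ξ hf hg
  rw [hf, hg, inner_ofReal_mul_left]

theorem schrodinger_isFormalAdjoint (V : Space → ℝ) :
    (schrodinger V).IsFormalAdjoint (schrodinger V) := by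
  have hsymm (f g : sobolevTwo) :
      ⟪-lapl f + mulOp (fun x => (V x : ℂ)) f, (g : Hil)⟫_ℂ =
        ⟪(f : Hil), -lapl g + mulOp (fun x => (V x : ℂ)) g⟫_ℂ := by
    rw [inner_add_left, inner_add_right, inner_neg_left, inner_neg_right, inner_lapl_left]
    exact congrArg _ (mulOp_ofReal_isSymmetric V f g)
  exact hsymm

/-! ### Resolvents of symmetric operators -/

theorem isUnit_one_sub_smul {𝔄 : Type*} [CStarAlgebra 𝔄] {a : 𝔄} (ha : IsSelfAdjoint a) {z : ℂ}
    (hz : z.im ≠ 0) : IsUnit (1 - z • a) := by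
  have hz0 : z ≠ 0 := by
    rintro rfl
    exact hz rfl
  have hspec : z⁻¹ ∉ spectrum ℂ a := fun hmem => by
    have him := ha.im_eq_zero_of_mem_spectrum hmem
    rw [Complex.inv_im, div_eq_zero_iff, neg_eq_zero, Complex.normSq_eq_zero] at him
    exact him.elim hz hz0
  have hfactor : 1 - z • a = Units.mk0 z hz0 • (algebraMap ℂ 𝔄 z⁻¹ - a) := by
    rw [smul_sub, Algebra.algebraMap_eq_smul_one, Units.smul_mk0, Units.smul_mk0,
      smul_inv_smul₀ hz0]
  rw [hfactor]
  exact (spectrum.notMem_iff.mp hspec).smul _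

section Resolvent

variable {H : Type*} [NormedAddCommGroup H] [InnerProductSpace ℂ H]

theorem inner_eq_inner_of_mem_graph {A : H →ₗ.[ℂ] H} (hA : A.IsFormalAdjoint A) {x y : H × H}
    (hx : x ∈ A.graph) (hy : y ∈ A.graph) : ⟪x.2, y.1⟫_ℂ = ⟪x.1, y.2⟫_ℂ := by
  obtain ⟨u, rfl⟩ := A.mem_graph_iff'.mp hx
  obtain ⟨v, rfl⟩ := A.mem_graph_iff'.mp hy
  exact hA u v

/-- `R` is the everywhere defined bounded inverse of `A - z`. In terms of the graph of `A` the
equation `(A - z) f = g` reads `(f, g + z f) ∈ graph A`, which spares all domain conditions. -/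
def IsResolvent (A : H →ₗ.[ℂ] H) (z : ℂ) (R : H →L[ℂ] H) : Prop :=
  ∀ f g : H, R g = f ↔ (f, g + z • f) ∈ A.graph

namespace IsResolvent

variable {A : H →ₗ.[ℂ] H} {z w : ℂ} {R S : H →L[ℂ] H}

theorem apply_mem_graph (hR : IsResolvent A z R) (g : H) : (R g, g + z • R g) ∈ A.graph :=
  (hR _ g).mp rfl

theorem apply_sub_smul (hR : IsResolvent A z R) {x : H × H} (hx : x ∈ A.graph) :
    R (x.2 - z • x.1) = x.1 :=
  (hR _ _).mpr (by rwa [sub_add_cancel])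

theorem eq_zero_of_apply_eq_zero (hR : IsResolvent A z R) {g : H} (hg : R g = 0) : g = 0 := by
  have hmem := (hR 0 g).mp hg
  rw [smul_zero, add_zero] at hmem
  exact A.mem_graph_snd_inj hmem A.graph.zero_mem rfl

theorem map_mem_graph (hR : IsResolvent A z R) {x : H × H} (hx : x ∈ A.graph) :
    (R x.1, R x.2) ∈ A.graph := by
  have hRx := hR.apply_sub_smul hx
  rw [map_sub, map_smul, sub_eq_iff_eq_add] at hRx
  rw [hRx]
  exact hR.apply_mem_graph x.1

theorem sub_eq_smul_mul (hR : IsResolvent A z R) (hS : IsResolvent A w S) :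
    R - S = (z - w) • (R * S) := by
  ext g
  have hSg : R (g + w • S g - z • S g) = S g := hR.apply_sub_smul (hS.apply_mem_graph g)
  have hg : g + w • S g - z • S g = g - (z - w) • S g := by module
  rw [hg, map_sub, map_smul] at hSg
  rw [sub_apply, smul_apply, mul_apply_eq_comp, sub_eq_iff_eq_add]
  exact sub_eq_iff_eq_add'.mp hSg

theorem mul_of_mul_eq_one (hR : IsResolvent A z R) {T : H →L[ℂ] H}
    (hleft : T * (1 - (w - z) • R) = 1) (hright : (1 - (w - z) • R) * T = 1) :
    IsResolvent A w (R * T) := by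
  intro f g
  constructor
  · rintro rfl
    have hTg : T g - (w - z) • R (T g) = g := DFunLike.congr_fun hright g
    have hg : g + w • R (T g) = T g + z • R (T g) := by
      rw [← sub_eq_zero, ← sub_eq_zero.mpr hTg.symm]
      module
    rw [mul_apply_eq_comp, hg]
    exact hR.apply_mem_graph (T g)
  · intro hf
    have hRf : R (g + w • f - z • f) = f := hR.apply_sub_smul hf
    have hg : (1 - (w - z) • R) (g + w • f - z • f) = g := by
      rw [sub_apply, smul_apply, hRf, one_apply_eq_self]
      module
    have hTg : T g = g + w • f - z • f := by
      conv_lhs => rw [← hg]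
      exact DFunLike.congr_fun hleft _
    rw [mul_apply_eq_comp, hTg, hRf]

theorem exists_of_im_ne_zero [CompleteSpace H] (hR : IsResolvent A z R) (hsa : IsSelfAdjoint R)
    (hw : (w - z).im ≠ 0) : ∃ S, IsResolvent A w S := by
  obtain ⟨u, hu⟩ := isUnit_one_sub_smul hsa hw
  exact ⟨_, hR.mul_of_mul_eq_one (hu ▸ u.inv_mul) (hu ▸ u.mul_inv)⟩

theorem adjoint_eq [CompleteSpace H] (hA : A.IsFormalAdjoint A) (hR : IsResolvent A z R)
    (hS : IsResolvent A (star z) S) : R.adjoint = S := by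
  refine ((ContinuousLinearMap.eq_adjoint_iff S R).mpr fun g h => ?_).symm
  have hsymm := inner_eq_inner_of_mem_graph hA (hS.apply_mem_graph g) (hR.apply_mem_graph h)
  rw [inner_add_left, inner_add_right, inner_smul_left, inner_smul_right, starRingEnd_apply,
    star_star] at hsymm
  exact (add_right_cancel hsymm).symm

theorem isSelfAdjoint [CompleteSpace H] (hA : A.IsFormalAdjoint A) {r : ℝ}
    (hR : IsResolvent A r R) : IsSelfAdjoint R :=
  hR.adjoint_eq hA (by rwa [RCLike.star_def, Complex.conj_ofReal])

theorem norm_le (hA : A.IsFormalAdjoint A) (hR : IsResolvent A z R) (hz : z.im ≠ 0) :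
    ‖R‖ ≤ |z.im|⁻¹ := by
  refine R.opNorm_le_bound (by positivity) fun g => ?_
  have hreal : (⟪R g, g + z • R g⟫_ℂ).im = 0 := by
    have hmem := hR.apply_mem_graph g
    rw [← Complex.conj_eq_iff_im, inner_conj_symm]
    exact inner_eq_inner_of_mem_graph hA hmem hmem
  have him : z.im * ‖R g‖ ^ 2 = -(⟪R g, g⟫_ℂ).im := by
    have hself : ⟪R g, R g⟫_ℂ = ((‖R g‖ ^ 2 : ℝ) : ℂ) := by
      exact_mod_cast inner_self_eq_norm_sq_to_K (𝕜 := ℂ) (R g)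
    rw [inner_add_right, inner_smul_right, hself, Complex.add_im, Complex.im_mul_ofReal] at hreal
    linarith
  have hle : |z.im| * ‖R g‖ ^ 2 ≤ ‖R g‖ * ‖g‖ := by
    rw [← abs_of_nonneg (sq_nonneg ‖R g‖), ← abs_mul, him, abs_neg]
    exact (Complex.abs_im_le_norm _).trans (norm_inner_le_norm _ _)
  rw [← div_eq_inv_mul, le_div_iff₀' (by positivity)]
  rcases (norm_nonneg (R g)).eq_or_lt with h0 | hpos
  · simp [← h0]
  · exact le_of_mul_le_mul_right (by linarith) hpos

end IsResolvent

end Resolvent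

section SelfAdjoint

variable {H : Type*} [NormedAddCommGroup H] [InnerProductSpace ℂ H]

open Classical in
/-- The resolvent `(A - z)⁻¹`, with the junk value `0` when `z` is in the spectrum of `A`. -/
def resolventOp (A : H →ₗ.[ℂ] H) (z : ℂ) : H →L[ℂ] H :=
  if h : ∃ R, IsResolvent A z R then h.choose else 0

/-- Self-adjointness of an unbounded operator, in the form of the basic criterion: `A` is symmetric
and every non-real number belongs to its resolvent set. -/
structure IsSelfAdjointOperator (A : H →ₗ.[ℂ] H) : Prop where
  symmetric : A.IsFormalAdjoint A
  exists_isResolvent : ∀ z : ℂ, z.im ≠ 0 → ∃ R, IsResolvent A z R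

theorem IsResolvent.isSelfAdjointOperator [CompleteSpace H] {A : H →ₗ.[ℂ] H}
    (hA : A.IsFormalAdjoint A) {r : ℝ} {R : H →L[ℂ] H} (hR : IsResolvent A r R) :
    IsSelfAdjointOperator A where
  symmetric := hA
  exists_isResolvent z hz := hR.exists_of_im_ne_zero (hR.isSelfAdjoint hA)
    (by rwa [Complex.sub_im, Complex.ofReal_im, sub_zero])

namespace IsSelfAdjointOperator

variable {A : H →ₗ.[ℂ] H} {z : ℂ} {ε : ℝ}

theorem isResolvent_resolventOp (hA : IsSelfAdjointOperator A) (hz : z.im ≠ 0) :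
    IsResolvent A z (resolventOp A z) := by
  have h := hA.exists_isResolvent z hz
  rw [resolventOp, dif_pos h]
  exact h.choose_spec

theorem star_resolventOp [CompleteSpace H] (hA : IsSelfAdjointOperator A) (hz : z.im ≠ 0) :
    star (resolventOp A z) = resolventOp A (star z) :=
  (hA.isResolvent_resolventOp hz).adjoint_eq hA.symmetric
    (hA.isResolvent_resolventOp (by simpa using hz))

theorem norm_resolventOp_le (hA : IsSelfAdjointOperator A) (hz : z.im ≠ 0) :
    ‖resolventOp A z‖ ≤ |z.im|⁻¹ :=
  (hA.isResolvent_resolventOp hz).norm_le hA.symmetric hz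

theorem continuous_resolventOp_add_mul_I (hA : IsSelfAdjointOperator A) (hε : ε ≠ 0) :
    Continuous fun e : ℝ => resolventOp A (e + ε * Complex.I) := by
  refine (LipschitzWith.of_dist_le' (K := |ε|⁻¹ * |ε|⁻¹) fun e e' => ?_).continuous
  have him (t : ℝ) : (t + ε * Complex.I).im = ε := by simp
  have hR (t : ℝ) := hA.isResolvent_resolventOp (z := t + ε * Complex.I) ((him t).symm ▸ hε)
  have hnorm (t : ℝ) : ‖resolventOp A (t + ε * Complex.I)‖ ≤ |ε|⁻¹ :=
    (hA.norm_resolventOp_le ((him t).symm ▸ hε)).trans_eq (by rw [him])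
  rw [dist_eq_norm, (hR e).sub_eq_smul_mul (hR e'), add_sub_add_right_eq_sub, norm_smul,
    ← Complex.ofReal_sub, Complex.norm_real, ← dist_eq_norm, mul_comm]
  gcongr
  exact (norm_mul_le _ _).trans (by gcongr <;> exact hnorm _)

end IsSelfAdjointOperator

theorem commute_starProjection {𝕜 E : Type*} [RCLike 𝕜] [NormedAddCommGroup E]
    [InnerProductSpace 𝕜 E] [CompleteSpace E] {K : Submodule 𝕜 E} [K.HasOrthogonalProjection]
    {T : E →L[𝕜] E} (hT : K ∈ Module.End.invtSubmodule T.toLinearMap)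
    (hT' : K ∈ Module.End.invtSubmodule T.adjoint.toLinearMap) :
    Commute K.starProjection T := by
  rw [ContinuousLinearMap.IsIdempotentElem.commute_iff K.isIdempotentElem_starProjection,
    Submodule.range_starProjection, Submodule.ker_starProjection]
  exact ⟨hT, T.orthogonal_mem_invtSubmodule hT'⟩

end SelfAdjoint

section Spectral

variable {A : Hil →ₗ.[ℂ] Hil} {z : ℂ} {e ε : ℝ}

theorem exists_shift_eq_iff {f g : Hil} :
    (∃ hf : f ∈ (shift A z).domain, shift A z ⟨f, hf⟩ = g) ↔ (f, g + z • f) ∈ A.graph := by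
  rw [LinearPMap.mem_graph_iff']
  constructor
  · rintro ⟨hf, rfl⟩
    exact ⟨⟨f, hf⟩, Prod.ext rfl (sub_add_cancel _ _).symm⟩
  · rintro ⟨⟨f', hf'⟩, h⟩
    obtain ⟨rfl, h⟩ := Prod.mk_inj.mp h
    exact ⟨hf', sub_eq_iff_eq_add.mpr h⟩

theorem mem_resolventSet_iff : z ∈ resolventSet A ↔ ∃ R, IsResolvent A z R := by
  simp only [resolventSet, exists_shift_eq_iff, IsResolvent, mem_ofPred_eq]

theorem mem_eigenspace_iff {f : Hil} : f ∈ eigenspace A z ↔ (f, z • f) ∈ A.graph := by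
  rw [← zero_add (z • f), ← exists_shift_eq_iff]
  exact ⟨fun ⟨f', hf', h⟩ => h ▸ ⟨f'.2, hf'⟩, fun ⟨hf, h⟩ => ⟨⟨f, hf⟩, h, rfl⟩⟩

theorem isInverseSqAdd_iff {B : BddOp} : IsInverseSqAdd A e ε B ↔ ∀ f g : Hil, B g = f ↔
    ∃ v, (f, v + (e : ℂ) • f) ∈ A.graph ∧
      (v, g - ((ε ^ 2 : ℝ) : ℂ) • f + (e : ℂ) • v) ∈ A.graph := by
  refine forall₂_congr fun f g => iff_congr Iff.rfl ?_
  simp only [← exists_shift_eq_iff, eq_sub_iff_add_eq]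
  constructor
  · rintro ⟨hf, hf', h⟩
    exact ⟨_, ⟨hf, rfl⟩, hf', h⟩
  · rintro ⟨v, ⟨hf, rfl⟩, hf', h⟩
    exact ⟨hf, hf', h⟩

theorem inverseSqAdd_eq {B : BddOp} (hB : IsInverseSqAdd A e ε B) : inverseSqAdd A e ε = B := by
  have h : ∃ B, IsInverseSqAdd A e ε B := ⟨B, hB⟩
  rw [inverseSqAdd, dif_pos h]
  ext1 g
  exact (h.choose_spec _ g).mpr ((hB _ g).mp rfl)

-- `(A - e)² + ε² = (A - e - iε) (A - e + iε)`
theorem IsResolvent.isInverseSqAdd_mul {R S : BddOp}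
    (hR : IsResolvent A (e - ε * Complex.I) R) (hS : IsResolvent A (e + ε * Complex.I) S) :
    IsInverseSqAdd A e ε (R * S) := by
  rw [isInverseSqAdd_iff]
  intro f g
  constructor
  · rintro rfl
    have hu := hS.apply_mem_graph g
    have hf := hR.apply_mem_graph (S g)
    refine ⟨S g - (ε * Complex.I) • R (S g), ?_, ?_⟩
    · convert hf using 1
      refine Prod.ext rfl ?_
      simp only [mul_apply_eq_comp]
      module
    · convert A.graph.sub_mem hu (A.graph.smul_mem (ε * Complex.I) hf) using 1
      refine Prod.ext rfl ?_
      simp only [mul_apply_eq_comp, Prod.smul_mk, Prod.mk_sub_mk]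
      match_scalars <;> grind [Complex.I_sq]
  · rintro ⟨v, hf, hv⟩
    have hu : (v + (ε * Complex.I) • f, g + (e + ε * Complex.I) • (v + (ε * Complex.I) • f)) ∈
        A.graph := by
      convert A.graph.add_mem hv (A.graph.smul_mem (ε * Complex.I) hf) using 1
      refine Prod.ext rfl ?_
      simp only [Prod.smul_mk, Prod.mk_add_mk]
      match_scalars <;> grind [Complex.I_sq]
    rw [mul_apply_eq_comp, (hS _ g).mpr hu, hR]
    convert hf using 1
    exact Prod.ext rfl (by module)

end Spectral

section Lorentz

variable {A : Hil →ₗ.[ℂ] Hil} {z : ℂ} {e ε : ℝ}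

theorem IsResolvent.eigenspace_mem_invtSubmodule {R : BddOp} (hR : IsResolvent A z R) (w : ℂ) :
    eigenspace A w ∈ Module.End.invtSubmodule R.toLinearMap := by
  rw [Module.End.mem_invtSubmodule_iff_forall_mem_of_mem]
  intro f hf
  rw [mem_eigenspace_iff] at hf ⊢
  exact map_smul R w f ▸ hR.map_mem_graph hf

theorem IsResolvent.iSup_eigenspace_mem_invtSubmodule {R : BddOp} (hR : IsResolvent A z R)
    (s : Set ℝ) : (⨆ w ∈ s, eigenspace A (w : ℂ)).topologicalClosure ∈
      Module.End.invtSubmodule R.toLinearMap := by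
  refine Submodule.topologicalClosure_mem_invtSubmodule ?_
  rw [Module.End.mem_invtSubmodule_iff_map_le]
  simp only [Submodule.map_iSup]
  exact iSup₂_mono fun w _ =>
    (Module.End.mem_invtSubmodule_iff_map_le _).mp (hR.eigenspace_mem_invtSubmodule w)

theorem norm_essProj_le : ‖essProj A‖ ≤ 1 := by
  rw [essProj, discProj, ContinuousLinearMap.one_def, ← Submodule.starProjection_orthogonal]
  exact Submodule.starProjection_norm_le _

theorem isStarProjection_essProj : IsStarProjection (essProj A) :=
  isStarProjection_starProjection.one_sub

namespace IsSelfAdjointOperator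

theorem commute_essProj_resolventOp (hA : IsSelfAdjointOperator A) (hz : z.im ≠ 0) :
    Commute (essProj A) (resolventOp A z) := by
  refine (Commute.one_left _).sub_left (commute_starProjection ?_ ?_)
  · exact (hA.isResolvent_resolventOp hz).iSup_eigenspace_mem_invtSubmodule _
  · rw [← ContinuousLinearMap.star_eq_adjoint, hA.star_resolventOp hz]
    exact (hA.isResolvent_resolventOp (by simpa using hz)).iSup_eigenspace_mem_invtSubmodule _

theorem inverseSqAdd_eq_star_mul_self (hA : IsSelfAdjointOperator A) (hε : ε ≠ 0) :
    inverseSqAdd A e ε =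
      star (resolventOp A (e + ε * Complex.I)) * resolventOp A (e + ε * Complex.I) := by
  have hz : ((e : ℂ) + ε * Complex.I).im ≠ 0 := by simpa using hε
  have hstar : star ((e : ℂ) + ε * Complex.I) = e - ε * Complex.I := by
    simp [sub_eq_add_neg]
  have hR := hA.isResolvent_resolventOp (z := star ((e : ℂ) + ε * Complex.I)) (by simpa using hε)
  rw [← hA.star_resolventOp hz, hstar] at hR
  exact inverseSqAdd_eq (hR.isInverseSqAdd_mul (hA.isResolvent_resolventOp hz))

theorem lorentz_eq_smul_star_mul_self (hA : IsSelfAdjointOperator A) (hε : ε ≠ 0) :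
    lorentz A e ε = (ε : ℂ) • (star (resolventOp A (e + ε * Complex.I) * essProj A) *
      (resolventOp A (e + ε * Complex.I) * essProj A)) := by
  have hz : ((e : ℂ) + ε * Complex.I).im ≠ 0 := by simpa using hε
  set S := resolventOp A (e + ε * Complex.I)
  have hcomm : Commute (essProj A) S := hA.commute_essProj_resolventOp hz
  have hP : IsStarProjection (essProj A) := isStarProjection_essProj
  have hcomm' : Commute (essProj A) (star S) := by
    simpa only [hP.isSelfAdjoint.star_eq] using hcomm.star_star
  rw [lorentz, hA.inverseSqAdd_eq_star_mul_self hε, star_mul, hP.isSelfAdjoint.star_eq]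
  congr 1
  calc essProj A * (star S * S)
      = essProj A * essProj A * (star S * S) := by rw [hP.isIdempotentElem.eq]
    _ = essProj A * star S * (S * essProj A) := by
      rw [mul_assoc, mul_assoc, (hcomm'.mul_right hcomm).eq, mul_assoc]

open scoped ComplexOrder in
theorem lorentz_nonneg (hA : IsSelfAdjointOperator A) (hε : 0 < ε) : 0 ≤ lorentz A e ε := by
  rw [hA.lorentz_eq_smul_star_mul_self hε.ne']
  exact smul_nonneg (Complex.zero_le_real.mpr hε.le) (star_mul_self_nonneg _)

theorem norm_lorentz_le (hA : IsSelfAdjointOperator A) (hε : 0 < ε) :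
    ‖lorentz A e ε‖ ≤ ε⁻¹ := by
  have hS : ‖resolventOp A (e + ε * Complex.I) * essProj A‖ ≤ ε⁻¹ := by
    have hz : ((e : ℂ) + ε * Complex.I).im = ε := by simp
    have h := hA.norm_resolventOp_le (hz.trans_ne hε.ne')
    rw [hz, abs_of_pos hε] at h
    simpa using (norm_mul_le _ _).trans
      (mul_le_mul h norm_essProj_le (norm_nonneg _) (by positivity))
  rw [hA.lorentz_eq_smul_star_mul_self hε.ne', norm_smul, CStarRing.norm_star_mul_self (E := BddOp),
    Complex.norm_real, Real.norm_of_nonneg hε.le]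
  calc ε * _ ≤ ε * (ε⁻¹ * ε⁻¹) := by gcongr
    _ = ε⁻¹ := by field_simp

theorem continuous_lorentz (hA : IsSelfAdjointOperator A) (hε : ε ≠ 0) :
    Continuous fun e => lorentz A e ε := by
  have hS := (hA.continuous_resolventOp_add_mul_I hε).mul_const (essProj A)
  simp only [hA.lorentz_eq_smul_star_mul_self hε]
  exact (hS.star.mul hS).const_smul (ε : ℂ)

theorem essProj_eq_zero_of_inner_lorentz_eq_zero (hA : IsSelfAdjointOperator A) (hε : ε ≠ 0)
    {f : Hil} (hf : ⟪f, lorentz A e ε f⟫_ℂ = 0) : essProj A f = 0 := by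
  rw [hA.lorentz_eq_smul_star_mul_self hε, smul_apply, inner_smul_right,
    mul_apply_eq_comp, ContinuousLinearMap.star_eq_adjoint,
    ContinuousLinearMap.adjoint_inner_right, mul_eq_zero, inner_self_eq_zero,
    Complex.ofReal_eq_zero] at hf
  exact (hA.isResolvent_resolventOp (by simpa using hε)).eq_zero_of_apply_eq_zero
    (hf.resolve_left hε)

end IsSelfAdjointOperator

end Lorentz

/-! ### Simple eigenvalues -/

section SimpleEigenvalue

variable {A : Hil →ₗ.[ℂ] Hil} {E : ℝ} {φ : Hil}

theorem exists_norm_eq_one_of_finrank_eq_one {𝕜 F : Type*} [RCLike 𝕜] [NormedAddCommGroup F]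
    [NormedSpace 𝕜 F] {K : Submodule 𝕜 F} (hK : Module.finrank 𝕜 K = 1) :
    ∃ φ : F, ‖φ‖ = 1 ∧ φ ∈ K := by
  have : Nontrivial K := Module.nontrivial_of_finrank_pos (R := 𝕜) (hK ▸ one_pos)
  obtain ⟨x, hx⟩ := exists_ne (0 : K)
  exact ⟨((‖x‖ : 𝕜)⁻¹) • (x : F), norm_smul_inv_norm (by simpa using hx), K.smul_mem _ x.2⟩

theorem eq_span_singleton_of_finrank_eq_one {𝕜 F : Type*} [Field 𝕜] [AddCommGroup F] [Module 𝕜 F]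
    {K : Submodule 𝕜 F} (hK : Module.finrank 𝕜 K = 1) {x : F} (hx : x ∈ K) (hx0 : x ≠ 0) :
    K = 𝕜 ∙ x := by
  have : FiniteDimensional 𝕜 K := Module.finite_of_finrank_pos (hK ▸ one_pos)
  exact (Submodule.eq_of_le_of_finrank_eq ((Submodule.span_singleton_le_iff_mem _ _).mpr hx)
    ((finrank_span_singleton hx0).trans hK.symm)).symm

theorem eigenProj_apply (hE : Module.finrank ℂ (eigenspace A E) = 1) (hφ : φ ∈ eigenspace A E)
    (hφ1 : ‖φ‖ = 1) (f : Hil) : eigenProj A E f = ⟪φ, f⟫_ℂ • φ := by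
  have hφ0 : φ ≠ 0 := norm_ne_zero_iff.mp (hφ1 ▸ one_ne_zero)
  have hspan : (eigenspace A E).topologicalClosure = ℂ ∙ φ := by
    rw [eq_span_singleton_of_finrank_eq_one hE hφ hφ0]
    exact (Submodule.closed_of_finiteDimensional _).submodule_topologicalClosure_eq
  rw [← Submodule.starProjection_unit_singleton ℂ hφ1 f]
  simp only [eigenProj, hspan]

theorem discProj_eq_eigenProj (hdisc : discreteSpectrum A = {E}) :
    discProj A = eigenProj A E := by
  simp only [discProj, eigenProj, hdisc, iSup_singleton]

theorem essProj_apply_eq_zero_iff (hdisc : discreteSpectrum A = {E}) {f : Hil} :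
    essProj A f = 0 ↔ f = eigenProj A E f := by
  rw [essProj, discProj_eq_eigenProj hdisc, sub_apply, one_apply_eq_self, sub_eq_zero]

theorem eigenProj_comp_comp_eigenProj (hE : Module.finrank ℂ (eigenspace A E) = 1)
    (hφ : φ ∈ eigenspace A E) (hφ1 : ‖φ‖ = 1) (T : BddOp) :
    eigenProj A E ∘L T ∘L eigenProj A E = ⟪φ, T φ⟫_ℂ • eigenProj A E := by
  ext1 f
  simp only [ContinuousLinearMap.comp_apply, smul_apply, eigenProj_apply hE hφ hφ1, map_smul,
    inner_smul_right, smul_smul, mul_comm]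

theorem eigenProj_comp_comp_mono {S T : BddOp} (h : S ≤ T) :
    eigenProj A E ∘L S ∘L eigenProj A E ≤ eigenProj A E ∘L T ∘L eigenProj A E := by
  have hp : star (eigenProj A E) = eigenProj A E :=
    isStarProjection_starProjection.isSelfAdjoint.star_eq
  have hle := star_left_conjugate_le_conjugate h (eigenProj A E)
  rwa [hp, mul_assoc, mul_assoc] at hle

end SimpleEigenvalue

/-! ### The coupling operators -/

section Coupling

variable {F : Type*} [NormedAddCommGroup F] [InnerProductSpace ℝ F]

/-- The plane wave `x ↦ e^{i q·x}` with wave vector `q`. -/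
def planeWave (q x : F) : ℂ :=
  Complex.exp (Complex.I * ((⟪q, x⟫_ℝ : ℝ) : ℂ))

theorem norm_planeWave (q x : F) : ‖planeWave q x‖ = 1 := by
  rw [planeWave, mul_comm, Complex.norm_exp_ofReal_mul_I]

theorem continuous_planeWave (q : F) : Continuous (planeWave q) := by
  unfold planeWave
  fun_prop

theorem planeWave_add (q q' x : F) :
    planeWave (q + q') x = planeWave q x * planeWave q' x := by
  rw [planeWave, inner_add_left, Complex.ofReal_add, mul_add, Complex.exp_add, planeWave, planeWave]

theorem norm_planeWave_sub_le (q q' x : F) :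
    ‖planeWave q x - planeWave q' x‖ ≤ ‖q - q'‖ * ‖x‖ := by
  have hfactor : planeWave q x - planeWave q' x = planeWave q' x * (planeWave (q - q') x - 1) := by
    rw [mul_sub, mul_one, ← planeWave_add, add_sub_cancel]
  rw [hfactor, norm_mul, norm_planeWave, one_mul]
  exact Real.norm_exp_I_mul_ofReal_sub_one_le.trans (norm_inner_le_norm _ _)

variable {g : Space → ℂ} {C : ℝ}

theorem memLp_planeWave_mul (hg : MemLp g ∞ volume) (q : Space) :
    MemLp (planeWave q * g) ∞ volume :=
  hg.of_le ((continuous_planeWave q).aestronglyMeasurable.mul hg.1) <| by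
    simp [norm_planeWave]

theorem continuous_mulOp_planeWave_mul (hg : MemLp g ∞ volume) (hC : ∀ x, ‖x‖ * ‖g x‖ ≤ C) :
    Continuous fun q => mulOp (planeWave q * g) := by
  refine (LipschitzWith.of_dist_le' (K := C) fun q q' => ?_).continuous
  rw [dist_eq_norm, dist_eq_norm,
    ← mulOp_sub (memLp_planeWave_mul hg q) (memLp_planeWave_mul hg q'), ← sub_mul]
  refine norm_mulOp_le fun x => ?_
  rw [Pi.mul_apply, Pi.sub_apply, norm_mul]
  calc ‖planeWave q x - planeWave q' x‖ * ‖g x‖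
      ≤ ‖q - q'‖ * ‖x‖ * ‖g x‖ := by gcongr; exact norm_planeWave_sub_le q q' x
    _ = ‖x‖ * ‖g x‖ * ‖q - q'‖ := by ring
    _ ≤ C * ‖q - q'‖ := by gcongr; exact hC x

variable (χ : 𝓢(Space, ℂ)) (α : ℝ) (κ : ℝ → ℂ)

theorem memLp_schwartz_comp_smul : MemLp (fun x => χ (α • x)) ∞ volume :=
  memLp_top_of_bound (χ.continuous.comp (continuous_const_smul α)).aestronglyMeasurable _
    (.of_forall fun x => χ.norm_le_seminorm ℝ (α • x))

theorem couplingFun_eq (k : ℝ × Dir) :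
    couplingFun κ χ α k = κ k.1 • (planeWave (k.1 • (k.2 : Space)) * fun x => χ (α • x)) := by
  ext x
  rw [couplingFun, Pi.smul_apply, Pi.mul_apply, planeWave, real_inner_smul_left, smul_eq_mul,
    mul_assoc]

theorem memLp_couplingFun (k : ℝ × Dir) : MemLp (couplingFun κ χ α k) ∞ volume :=
  couplingFun_eq χ α κ k ▸ (memLp_planeWave_mul (memLp_schwartz_comp_smul χ α) _).const_smul _

theorem coupling_eq_smul (k : ℝ × Dir) : coupling κ χ α k =
    κ k.1 • mulOp (planeWave (k.1 • (k.2 : Space)) * fun x => χ (α • x)) := by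
  rw [coupling, couplingFun_eq,
    mulOp_const_smul (memLp_planeWave_mul (memLp_schwartz_comp_smul χ α) _)]

theorem norm_coupling_le (k : ℝ × Dir) :
    ‖coupling κ χ α k‖ ≤ SchwartzMap.seminorm ℝ 0 0 χ * ‖κ k.1‖ := by
  refine norm_mulOp_le fun x => ?_
  rw [couplingFun_eq, Pi.smul_apply, Pi.mul_apply, norm_smul, norm_mul, norm_planeWave, one_mul,
    mul_comm]
  exact mul_le_mul_of_nonneg_right (χ.norm_le_seminorm ℝ _) (norm_nonneg _)

variable {κ}

theorem exists_norm_coupling_le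
    (hκ : IntegrableOn (fun ω => (ω ^ 2 + ω) * ‖κ ω‖ ^ 2) (Ioi 0)) :
    ∃ ρ : ℝ → ℝ, IntegrableOn (fun ω => (ω ^ 2 + ω) * ρ ω ^ 2) (Ioi 0) ∧
      ∀ k, ‖coupling κ χ α k‖ ≤ ρ k.1 := by
  refine ⟨fun ω => SchwartzMap.seminorm ℝ 0 0 χ * ‖κ ω‖, ?_, norm_coupling_le χ α κ⟩
  simpa only [mul_pow, mul_left_comm, IntegrableOn] using
    Integrable.const_mul hκ (SchwartzMap.seminorm ℝ 0 0 χ ^ 2)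

variable {α}

theorem aestronglyMeasurable_coupling (hα : α ≠ 0)
    (hκ : AEStronglyMeasurable κ (volume.restrict (Ioi 0))) :
    AEStronglyMeasurable (coupling κ χ α) modeMeasure := by
  have hbound (x : Space) : ‖x‖ * ‖χ (α • x)‖ ≤ SchwartzMap.seminorm ℝ 1 0 χ / |α| := by
    rw [le_div_iff₀' (abs_pos.mpr hα), ← mul_assoc, ← Real.norm_eq_abs, ← norm_smul]
    simpa only [pow_one] using χ.norm_pow_mul_le_seminorm ℝ 1 (α • x)
  have hcont := continuous_mulOp_planeWave_mul (memLp_schwartz_comp_smul χ α) hbound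
  rw [funext (coupling_eq_smul χ α κ)]
  exact (hκ.comp_fst (ν := (volume : Measure Space).toSphere)).smul
    (hcont.comp (by fun_prop : Continuous fun k : ℝ × Dir => k.1 • (k.2 : Space))
      ).aestronglyMeasurable

end Coupling

/-! ### Form factors -/

section FormFactor

variable {κ : ℝ → ℂ}

theorem exists_norm_le_of_norm_le_rpow (hκ : ContinuousOn κ (Ioi 0)) {k₁ k₂ p : ℝ} (hk₁ : 0 < k₁)
    (hp : 0 ≤ p) (h : ∀ ω, 0 < ω → ω < k₁ → ‖κ ω‖ ≤ k₂ * ω ^ p) :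
    ∃ C, ∀ ω ∈ Ioc (0 : ℝ) 1, ‖κ ω‖ ≤ C := by
  obtain ⟨D, hD⟩ := isCompact_Icc.exists_bound_of_continuousOn
    (hκ.mono fun ω hω => hk₁.trans_le hω.1 : ContinuousOn κ (Icc k₁ 1))
  refine ⟨max |k₂| D, fun ω hω => ?_⟩
  rcases lt_or_ge ω k₁ with hlt | hge
  · refine (h ω hω.1 hlt).trans (le_max_of_le_left ?_)
    calc k₂ * ω ^ p ≤ |k₂| * 1 := by
          gcongr
          · exact Real.rpow_nonneg hω.1.le p
          · exact le_abs_self k₂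
          · exact Real.rpow_le_one hω.1.le hω.2 hp
      _ = |k₂| := mul_one _
  · exact (hD ω ⟨hge, hω.2⟩).trans (le_max_right _ _)

theorem mul_rpow_sq_le_one {ω s : ℝ} (hω : ω ∈ Ioc (0 : ℝ) 1) (hs : -(1 / 2) ≤ s) :
    ω * (ω ^ s) ^ 2 ≤ 1 := by
  have hpow : ω * (ω ^ s) ^ 2 = ω ^ (1 + s * 2) := by
    rw [Real.rpow_add hω.1, Real.rpow_one, Real.rpow_mul hω.1.le, Real.rpow_two]
  rw [hpow]
  exact Real.rpow_le_one hω.1.le hω.2 (by linarith)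

theorem InfraredBehavior.exists_mul_norm_sq_le (hκ : InfraredBehavior κ) :
    ∃ C, ∀ ω ∈ Ioc (0 : ℝ) 1, ω * ‖κ ω‖ ^ 2 ≤ C := by
  obtain ⟨hcont, ⟨k₁, k₂, p, hk₁, -, hp, h⟩ | ⟨s, κ', hs, -, hκ', h⟩⟩ := hκ
  · obtain ⟨C, hC⟩ := exists_norm_le_of_norm_le_rpow hcont.continuousOn hk₁ (by linarith)
      fun ω h0 h1 => by simpa using h 0 (Nat.zero_le 3) ω h0 h1
    refine ⟨C ^ 2, fun ω hω => ?_⟩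
    calc ω * ‖κ ω‖ ^ 2 ≤ 1 * C ^ 2 := by
          gcongr
          · exact hω.2
          · exact hC ω hω
      _ = C ^ 2 := one_mul _
  · obtain ⟨C, hC⟩ := hκ' 0 (Nat.zero_le 3)
    refine ⟨C ^ 2, fun ω hω => ?_⟩
    have hs' : -(1 / 2) ≤ s := by rcases hs with rfl | rfl <;> norm_num
    have hCω : ‖κ' ω‖ ≤ C := by simpa using hC ω hω.1.le
    calc ω * ‖κ ω‖ ^ 2 = ω * (ω ^ s) ^ 2 * ‖κ' ω‖ ^ 2 := by
          rw [h ω hω.1, norm_mul, Complex.norm_real, mul_pow, Real.norm_eq_abs, sq_abs, mul_assoc]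
      _ ≤ 1 * C ^ 2 := by
          gcongr
          exact mul_rpow_sq_le_one hω hs'
      _ = C ^ 2 := one_mul _

theorem UVCutoff.integrableOn_Ioi_one (hUV : UVCutoff κ) (hκ : ContinuousOn κ (Ioi 0)) :
    IntegrableOn (fun ω => (ω ^ 2 + ω) * ‖κ ω‖ ^ 2) (Ioi 1) := by
  have hcont : ContinuousOn κ (Ioi 1) := hκ.mono (Ioi_subset_Ioi zero_le_one)
  obtain ⟨C, hC⟩ := hUV 2
  have hdom : IntegrableOn (fun ω : ℝ => 2 * C ^ 2 * ω ^ (-2 : ℝ)) (Ioi 1) :=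
    (integrableOn_Ioi_rpow_of_lt (by norm_num) zero_lt_one).const_mul _
  refine hdom.mono' (ContinuousOn.aestronglyMeasurable (by fun_prop) measurableSet_Ioi)
    ((ae_restrict_mem measurableSet_Ioi).mono fun ω (hω : 1 < ω) => ?_)
  have hω0 : 0 < ω := zero_lt_one.trans hω
  have hbound : ω ^ 2 * ‖κ ω‖ ≤ C := hC ω hω.le
  rw [Real.norm_of_nonneg (by positivity), Real.rpow_neg hω0.le, Real.rpow_two, ← div_eq_mul_inv,
    le_div_iff₀ (by positivity)]
  calc (ω ^ 2 + ω) * ‖κ ω‖ ^ 2 * ω ^ 2 ≤ (ω ^ 2 + ω ^ 2) * ‖κ ω‖ ^ 2 * ω ^ 2 := by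
        gcongr
        nlinarith
    _ = 2 * (ω ^ 2 * ‖κ ω‖) ^ 2 := by ring
    _ ≤ 2 * C ^ 2 := by gcongr

theorem integrableOn_formFactor (hUV : UVCutoff κ) (hIR : InfraredBehavior κ) :
    IntegrableOn (fun ω => (ω ^ 2 + ω) * ‖κ ω‖ ^ 2) (Ioi 0) := by
  have hκ : ContinuousOn κ (Ioi 0) := hIR.1.continuousOn
  obtain ⟨C, hC⟩ := hIR.exists_mul_norm_sq_le
  rw [← Ioc_union_Ioi_eq_Ioi zero_le_one]
  refine IntegrableOn.union ?_ (hUV.integrableOn_Ioi_one hκ)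
  have hcont : ContinuousOn κ (Ioc 0 1) := hκ.mono Ioc_subset_Ioi_self
  have hmeas : ContinuousOn (fun ω => (ω ^ 2 + ω) * ‖κ ω‖ ^ 2) (Ioc 0 1) := by fun_prop
  refine (integrableOn_const (C := 2 * C) (by simp)).mono'
    (hmeas.aestronglyMeasurable measurableSet_Ioc)
    ((ae_restrict_mem measurableSet_Ioc).mono fun ω hω => ?_)
  have hω0 : 0 < ω := hω.1
  rw [Real.norm_of_nonneg (by positivity)]
  calc (ω ^ 2 + ω) * ‖κ ω‖ ^ 2 = (ω + 1) * (ω * ‖κ ω‖ ^ 2) := by ring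
    _ ≤ 2 * C := by
        gcongr
        · linarith [hω.2]
        · exact hC ω hω

theorem InfraredBehavior.aestronglyMeasurable (hκ : InfraredBehavior κ) :
    AEStronglyMeasurable κ (volume.restrict (Ioi 0)) :=
  hκ.1.continuousOn.aestronglyMeasurable measurableSet_Ioi

theorem InfraredBehavior.not_ae_eq_zero (hκ : InfraredBehavior κ) (hne : ∃ ω, 0 < ω ∧ κ ω ≠ 0) :
    ¬ κ =ᵐ[volume.restrict (Ioi 0)] 0 := by
  obtain ⟨ω, hω, hκω⟩ := hne
  exact fun hzero => hκω
    (Measure.eqOn_open_of_ae_eq hzero isOpen_Ioi hκ.1.continuousOn continuousOn_const hω)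

end FormFactor

/-! ### The level shift operators -/

section Weights

variable {β ω : ℝ}

theorem bose_weight_nonneg (hβ : 0 < β) (hω : 0 < ω) : 0 ≤ ω ^ 2 / (Real.exp (β * ω) - 1) :=
  div_nonneg (sq_nonneg ω) (sub_nonneg.mpr (Real.one_le_exp (by positivity)))

theorem bose_weight_le (hβ : 0 < β) (hω : 0 < ω) :
    ω ^ 2 / (Real.exp (β * ω) - 1) ≤ β⁻¹ * ω := by
  calc ω ^ 2 / (Real.exp (β * ω) - 1) ≤ ω ^ 2 / (β * ω) := by
        gcongr
        linarith [Real.add_one_le_exp (β * ω)]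
    _ = β⁻¹ * ω := by field_simp

theorem emission_weight_eq (hβ : 0 < β) (hω : 0 < ω) :
    ω ^ 2 / (1 - Real.exp (-(β * ω))) = ω ^ 2 + ω ^ 2 / (Real.exp (β * ω) - 1) := by
  have hexp : Real.exp (β * ω) - 1 ≠ 0 :=
    (sub_pos.mpr (Real.one_lt_exp_iff.mpr (by positivity))).ne'
  have hexp_neg : 1 - Real.exp (-(β * ω)) = (Real.exp (β * ω) - 1) / Real.exp (β * ω) := by
    rw [Real.exp_neg, sub_div, div_self (Real.exp_ne_zero _), one_div]
  rw [hexp_neg, div_div_eq_mul_div, div_eq_iff hexp, add_mul, div_mul_cancel₀ _ hexp]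
  ring

end Weights

section ModeIntegral

theorem ae_modeMeasure_pos : ∀ᵐ k ∂modeMeasure, 0 < k.1 :=
  Measure.quasiMeasurePreserving_fst.ae (ae_restrict_mem measurableSet_Ioi)

theorem ae_restrict_of_ae_modeMeasure {P : ℝ → Prop} (hP : ∀ᵐ k ∂modeMeasure, P k.1) :
    ∀ᵐ ω ∂(volume.restrict (Ioi 0)), P ω := by
  have : NeBot (ae (volume : Measure Space).toSphere) :=
    ae_neBot.mpr (Measure.toSphere_ne_zero _)
  exact (Measure.ae_ae_of_ae_prod hP).mono fun ω hω => eventually_const.mp hω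

theorem integrable_modeMeasure_of_norm_le {F : Type*} [NormedAddCommGroup F] {f : ℝ × Dir → F}
    {h : ℝ → ℝ} (hh : IntegrableOn h (Ioi 0)) (hf : AEStronglyMeasurable f modeMeasure)
    (hle : ∀ k, 0 < k.1 → ‖f k‖ ≤ h k.1) : Integrable f modeMeasure :=
  (Integrable.comp_fst hh _).mono' hf (ae_modeMeasure_pos.mono hle)

theorem integrable_smul_comp_comp {X Y : ℝ × Dir → BddOp} {L : ℝ → BddOp} {w ρ : ℝ → ℝ} {K c : ℝ}
    (hρ : IntegrableOn (fun ω => (ω ^ 2 + ω) * ρ ω ^ 2) (Ioi 0))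
    (hX : AEStronglyMeasurable X modeMeasure) (hXρ : ∀ k, ‖X k‖ ≤ ρ k.1)
    (hY : AEStronglyMeasurable Y modeMeasure) (hYρ : ∀ k, ‖Y k‖ ≤ ρ k.1)
    (hL : Continuous L) (hLK : ∀ ω, ‖L ω‖ ≤ K)
    (hw : Measurable w) (hwc : ∀ ω, 0 < ω → |w ω| ≤ c * (ω ^ 2 + ω)) :
    Integrable (fun k => (w k.1 : ℂ) • (X k ∘L L k.1 ∘L Y k)) modeMeasure := by
  refine integrable_modeMeasure_of_norm_le (hρ.const_mul (c * K)) ?_ fun k hk => ?_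
  · have hwk : Measurable fun k : ℝ × Dir => (w k.1 : ℂ) := by fun_prop
    have hLk : Continuous fun k : ℝ × Dir => L k.1 := hL.comp continuous_fst
    exact hwk.aestronglyMeasurable.smul (hX.mul (hLk.aestronglyMeasurable.mul hY))
  · have hρ0 : 0 ≤ ρ k.1 := (norm_nonneg _).trans (hXρ k)
    have hK0 : 0 ≤ K := (norm_nonneg _).trans (hLK k.1)
    have hcomp : ‖X k ∘L L k.1 ∘L Y k‖ ≤ ρ k.1 * (K * ρ k.1) :=
      (norm_mul_le _ _).trans (mul_le_mul (hXρ k) ((norm_mul_le _ _).trans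
        (mul_le_mul (hLK _) (hYρ k) (norm_nonneg _) hK0)) (norm_nonneg _) hρ0)
    rw [norm_smul, Complex.norm_real, Real.norm_eq_abs]
    calc |w k.1| * ‖X k ∘L L k.1 ∘L Y k‖
        ≤ c * (k.1 ^ 2 + k.1) * (ρ k.1 * (K * ρ k.1)) :=
          mul_le_mul (hwc _ hk) hcomp (norm_nonneg _) ((abs_nonneg _).trans (hwc _ hk))
      _ = c * K * ((k.1 ^ 2 + k.1) * ρ k.1 ^ 2) := by ring

end ModeIntegral

section LevelShift

open scoped ComplexOrder

instance : IsOrderedModule ℝ BddOp :=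
  IsOrderedModule.of_smul_nonneg fun a ha T hT => by
    rw [RCLike.real_smul_eq_coe_smul (K := ℂ)]
    exact smul_nonneg (RCLike.ofReal_nonneg.mpr ha) hT

theorem inner_integral_apply_pos {X H : Type*} [MeasurableSpace X] {μ : Measure X}
    [NormedAddCommGroup H] [InnerProductSpace ℂ H] [CompleteSpace H] {f : X → H →L[ℂ] H} {φ : H}
    (hf : Integrable f μ) (hf0 : ∀ᵐ k ∂μ, 0 ≤ f k) (hφ : ¬ ∀ᵐ k ∂μ, ⟪φ, f k φ⟫_ℂ = 0) :
    0 < ⟪φ, (∫ k, f k ∂μ) φ⟫_ℂ := by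
  have hpos : ∀ᵐ k ∂μ, 0 ≤ ⟪φ, f k φ⟫_ℂ := hf0.mono fun k hk =>
    ((ContinuousLinearMap.nonneg_iff_isPositive _).mp hk).inner_nonneg_right φ
  have hint : Integrable (fun k => ⟪φ, f k φ⟫_ℂ) μ := (hf.apply_continuousLinearMap φ).const_inner φ
  rw [ContinuousLinearMap.integral_apply hf, ← integral_inner (hf.apply_continuousLinearMap φ)]
  refine (integral_nonneg_of_ae hpos).lt_of_ne' fun hzero => hφ ?_
  have hre : ∫ k, RCLike.re ⟪φ, f k φ⟫_ℂ ∂μ = 0 := by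
    rw [integral_re hint, hzero, map_zero]
  have hre_zero := (integral_eq_zero_iff_of_nonneg_ae
    (hpos.mono fun k hk => (Complex.nonneg_iff.mp hk).1) hint.re).mp hre
  filter_upwards [hpos, hre_zero] with k hk hk_re
  exact Complex.ext hk_re (Complex.nonneg_iff.mp hk).2.symm

/-- The part of `F⁽²⁾_ε` that survives at zero temperature (`β → ∞`): the integral
`∫ ω² G(ω,Σ)^* (ε P_ess / ((A - E + ω)² + ε²)) G(ω,Σ) dΣ dω`, which describes spontaneous
emission. -/
def spontaneousEmission (A : Hil →ₗ.[ℂ] Hil) (G : ℝ × Dir → BddOp) (ε E : ℝ) : BddOp :=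
  ∫ k, ((k.1 ^ 2 : ℝ) : ℂ) • ((G k).adjoint ∘L lorentz A (E - k.1) ε ∘L G k) ∂modeMeasure

namespace IsSelfAdjointOperator

variable {A : Hil →ₗ.[ℂ] Hil} {G : ℝ × Dir → BddOp} {ρ : ℝ → ℝ} {β ε E : ℝ}

theorem integrable_spontaneousEmission (hA : IsSelfAdjointOperator A) (hε : 0 < ε)
    (hρ : IntegrableOn (fun ω => (ω ^ 2 + ω) * ρ ω ^ 2) (Ioi 0))
    (hG : AEStronglyMeasurable G modeMeasure) (hGρ : ∀ k, ‖G k‖ ≤ ρ k.1) :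
    Integrable (fun k : ℝ × Dir =>
      ((k.1 ^ 2 : ℝ) : ℂ) • ((G k).adjoint ∘L lorentz A (E - k.1) ε ∘L G k)) modeMeasure := by
  refine integrable_smul_comp_comp (L := fun ω => lorentz A (E - ω) ε) (w := fun ω => ω ^ 2)
    (c := 1) hρ (ContinuousLinearMap.adjoint.continuous.comp_aestronglyMeasurable hG)
    (fun k => (LinearIsometryEquiv.norm_map _ _).trans_le (hGρ k)) hG hGρ
    ((hA.continuous_lorentz hε.ne').comp (continuous_sub_left E)) (fun ω => hA.norm_lorentz_le hε)
    (by fun_prop) fun ω hω => ?_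
  rw [abs_of_nonneg (sq_nonneg ω)]
  linarith

theorem integrable_integrandOne (hA : IsSelfAdjointOperator A) (hβ : 0 < β) (hε : 0 < ε)
    (hρ : IntegrableOn (fun ω => (ω ^ 2 + ω) * ρ ω ^ 2) (Ioi 0))
    (hG : AEStronglyMeasurable G modeMeasure) (hGρ : ∀ k, ‖G k‖ ≤ ρ k.1) :
    Integrable (integrandOne A G β ε E) modeMeasure := by
  refine integrable_smul_comp_comp (L := fun ω => lorentz A (E + ω) ε)
    (w := fun ω => ω ^ 2 / (Real.exp (β * ω) - 1)) (c := β⁻¹) hρ hG hGρ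
    (ContinuousLinearMap.adjoint.continuous.comp_aestronglyMeasurable hG)
    (fun k => (LinearIsometryEquiv.norm_map _ _).trans_le (hGρ k))
    ((hA.continuous_lorentz hε.ne').comp (continuous_const_add E)) (fun ω => hA.norm_lorentz_le hε)
    (by fun_prop) fun ω hω => ?_
  rw [abs_of_nonneg (bose_weight_nonneg hβ hω)]
  refine (bose_weight_le hβ hω).trans ?_
  gcongr
  linarith [sq_nonneg ω]

theorem integrable_integrandTwo (hA : IsSelfAdjointOperator A) (hβ : 0 < β) (hε : 0 < ε)
    (hρ : IntegrableOn (fun ω => (ω ^ 2 + ω) * ρ ω ^ 2) (Ioi 0))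
    (hG : AEStronglyMeasurable G modeMeasure) (hGρ : ∀ k, ‖G k‖ ≤ ρ k.1) :
    Integrable (integrandTwo A G β ε E) modeMeasure := by
  refine integrable_smul_comp_comp (L := fun ω => lorentz A (E - ω) ε)
    (w := fun ω => ω ^ 2 / (1 - Real.exp (-(β * ω)))) (c := 1 + β⁻¹) hρ
    (ContinuousLinearMap.adjoint.continuous.comp_aestronglyMeasurable hG)
    (fun k => (LinearIsometryEquiv.norm_map _ _).trans_le (hGρ k)) hG hGρ
    ((hA.continuous_lorentz hε.ne').comp (continuous_sub_left E)) (fun ω => hA.norm_lorentz_le hε)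
    (by fun_prop) fun ω hω => ?_
  have hbose := bose_weight_nonneg hβ hω
  rw [emission_weight_eq hβ hω, abs_of_nonneg (by positivity)]
  calc ω ^ 2 + ω ^ 2 / (Real.exp (β * ω) - 1) ≤ ω ^ 2 + β⁻¹ * ω := by
        gcongr
        exact bose_weight_le hβ hω
    _ ≤ (1 + β⁻¹) * (ω ^ 2 + ω) := by
        linarith [mul_nonneg (inv_pos.mpr hβ).le (sq_nonneg ω)]

theorem conj_lorentz_nonneg (hA : IsSelfAdjointOperator A) (hε : 0 < ε) (e : ℝ) (X : BddOp) :
    0 ≤ X.adjoint ∘L lorentz A e ε ∘L X := by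
  have hconj := star_left_conjugate_nonneg (hA.lorentz_nonneg (e := e) hε) X
  rwa [mul_assoc] at hconj

theorem levelShiftOne_nonneg (hA : IsSelfAdjointOperator A) (hβ : 0 < β) (hε : 0 < ε) :
    0 ≤ levelShiftOne A G β ε E := by
  refine integral_nonneg_of_ae (ae_modeMeasure_pos.mono fun k hk => ?_)
  have hconj := hA.conj_lorentz_nonneg hε (E + k.1) (G k).adjoint
  rw [ContinuousLinearMap.adjoint_adjoint] at hconj
  exact smul_nonneg (by exact_mod_cast bose_weight_nonneg hβ hk) hconj

theorem spontaneousEmission_le_levelShiftTwo (hA : IsSelfAdjointOperator A) (hβ : 0 < β)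
    (hε : 0 < ε) (hρ : IntegrableOn (fun ω => (ω ^ 2 + ω) * ρ ω ^ 2) (Ioi 0))
    (hG : AEStronglyMeasurable G modeMeasure) (hGρ : ∀ k, ‖G k‖ ≤ ρ k.1) :
    spontaneousEmission A G ε E ≤ levelShiftTwo A G β ε E := by
  refine integral_mono_ae (hA.integrable_spontaneousEmission hε hρ hG hGρ)
    (hA.integrable_integrandTwo hβ hε hρ hG hGρ) (ae_modeMeasure_pos.mono fun k hk => ?_)
  have hweight : k.1 ^ 2 ≤ k.1 ^ 2 / (1 - Real.exp (-(β * k.1))) := by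
    rw [emission_weight_eq hβ hk]
    exact le_add_of_nonneg_right (bose_weight_nonneg hβ hk)
  exact smul_le_smul_of_nonneg_right (by exact_mod_cast hweight) (hA.conj_lorentz_nonneg hε _ _)

theorem inner_spontaneousEmission_pos (hA : IsSelfAdjointOperator A) (hε : 0 < ε)
    (hρ : IntegrableOn (fun ω => (ω ^ 2 + ω) * ρ ω ^ 2) (Ioi 0))
    (hG : AEStronglyMeasurable G modeMeasure) (hGρ : ∀ k, ‖G k‖ ≤ ρ k.1) {φ : Hil}
    (hφ : ¬ ∀ᵐ k ∂modeMeasure, essProj A (G k φ) = 0) :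
    0 < ⟪φ, spontaneousEmission A G ε E φ⟫_ℂ := by
  have hint := hA.integrable_spontaneousEmission (E := E) hε hρ hG hGρ
  have hnonneg (k : ℝ × Dir) : 0 ≤ ((k.1 ^ 2 : ℝ) : ℂ) •
      ((G k).adjoint ∘L lorentz A (E - k.1) ε ∘L G k) :=
    smul_nonneg (by exact_mod_cast sq_nonneg k.1) (hA.conj_lorentz_nonneg hε _ _)
  rw [spontaneousEmission]
  refine inner_integral_apply_pos hint (.of_forall hnonneg) fun hzero => hφ ?_
  filter_upwards [ae_modeMeasure_pos, hzero] with k hk hk_zero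
  have hk_ne : ((k.1 ^ 2 : ℝ) : ℂ) ≠ 0 := by exact_mod_cast (pow_pos hk 2).ne'
  rw [smul_apply, inner_smul_right, ContinuousLinearMap.comp_apply,
    ContinuousLinearMap.comp_apply, ContinuousLinearMap.adjoint_inner_right] at hk_zero
  exact hA.essProj_eq_zero_of_inner_lorentz_eq_zero hε.ne'
    ((mul_eq_zero.mp hk_zero).resolve_left hk_ne)

end IsSelfAdjointOperator

end LevelShift

/-! ### Level sets of plane waves -/

section LevelSets

variable {F : Type*} [NormedAddCommGroup F] [InnerProductSpace ℝ F] [FiniteDimensional ℝ F]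
  [MeasurableSpace F] [BorelSpace F] (μ : Measure F) [μ.IsAddHaarMeasure] {q : F}

theorem addHaar_setOf_inner_eq (hq : q ≠ 0) (t : ℝ) : μ {x | ⟪q, x⟫_ℝ = t} = 0 := by
  rcases eq_empty_or_nonempty {x | ⟪q, x⟫_ℝ = t} with hempty | ⟨x₀, hx₀ : ⟪q, x₀⟫_ℝ = t⟩
  · rw [hempty, measure_empty]
  have hmem (x : F) : x ∈ AffineSubspace.mk' x₀ (ℝ ∙ q)ᗮ ↔ ⟪q, x⟫_ℝ = t := by
    rw [AffineSubspace.mem_mk', vsub_eq_sub, Submodule.mem_orthogonal_singleton_iff_inner_right,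
      inner_sub_right, hx₀, sub_eq_zero]
  have hproper : AffineSubspace.mk' x₀ (ℝ ∙ q)ᗮ ≠ ⊤ := by
    intro htop
    have hq_inner : ⟪q, x₀ + q⟫_ℝ = t := (hmem _).mp (htop ▸ AffineSubspace.mem_top _ _ _)
    rw [inner_add_right, hx₀, add_eq_left, inner_self_eq_zero] at hq_inner
    exact hq hq_inner
  exact measure_mono_null (fun x hx => (hmem x).mpr hx)
    (Measure.addHaar_affineSubspace μ _ hproper)

theorem addHaar_setOf_planeWave_eq (hq : q ≠ 0) (a : ℂ) :
    μ {x | planeWave q x = a} = 0 := by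
  rcases eq_empty_or_nonempty {x | planeWave q x = a} with hempty | ⟨x₀, rfl⟩
  · rw [hempty, measure_empty]
  · refine measure_mono_null (t := ⋃ n : ℤ, {x | ⟪q, x⟫_ℝ = ⟪q, x₀⟫_ℝ + n * (2 * Real.pi)})
      (fun x hx => ?_) (measure_iUnion_null fun n => addHaar_setOf_inner_eq μ hq _)
    obtain ⟨n, hn⟩ := Complex.exp_eq_exp_iff_exists_int.mp hx
    exact mem_iUnion.mpr ⟨n, by simpa using congrArg Complex.im hn⟩

variable {χ : 𝓢(Space, ℂ)} {c : ℂ} {φ : Hil}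

theorem coupling_apply_ne_smul (hc : c ≠ 0) {α : ℝ}
    (hS : volume {x | χ (α • x) = c ∧ φ x ≠ 0} ≠ 0) {κ : ℝ → ℂ} {k : ℝ × Dir} (hk : 0 < k.1)
    (hκ : κ k.1 ≠ 0) (a : ℂ) : coupling κ χ α k φ ≠ a • φ := by
  intro heq
  have hq : k.1 • (k.2 : Space) ≠ 0 := smul_ne_zero hk.ne' (ne_zero_of_mem_unit_sphere k.2)
  have hwave : ∀ᵐ x, planeWave (k.1 • (k.2 : Space)) x ≠ a / (κ k.1 * c) :=
    measure_eq_zero_iff_ae_notMem.mp (addHaar_setOf_planeWave_eq volume hq _)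
  refine hS (measure_eq_zero_iff_ae_notMem.mpr ?_)
  filter_upwards [hwave, mulOp_coeFn (memLp_couplingFun χ α κ k) φ, Lp.coeFn_smul a φ]
    with x hx hmul hsmul ⟨hχx, hφx⟩
  have hval : couplingFun κ χ α k x * φ x = a * φ x := by
    rw [← hmul, ← smul_eq_mul, ← Pi.smul_apply, ← hsmul, ← heq, coupling]
  have hfun := mul_right_cancel₀ hφx hval
  simp only [couplingFun_eq, Pi.smul_apply, Pi.mul_apply, hχx, smul_eq_mul] at hfun
  exact hx ((eq_div_iff (mul_ne_zero hκ hc)).mpr (by rw [← hfun]; ring))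

theorem exists_scale (hχ : ∀ᶠ x in 𝓝 (0 : Space), χ x = c) (hφ : φ ≠ 0) :
    ∃ α : ℝ, 0 < α ∧ volume {x | χ (α • x) = c ∧ φ x ≠ 0} ≠ 0 := by
  obtain ⟨r, hr, hball⟩ := Metric.eventually_nhds_iff.mp hχ
  by_contra! hnull
  refine hφ (Lp.eq_zero_iff_ae_eq_zero.mpr ?_)
  refine measure_mono_null (t := ⋃ n : ℕ, {x | χ ((r / (n + 1)) • x) = c ∧ φ x ≠ 0})
    (fun x hx => ?_) (measure_iUnion_null fun n => hnull _ (by positivity))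
  obtain ⟨n, hn⟩ := exists_nat_gt ‖x‖
  refine mem_iUnion.mpr ⟨n, hball ?_, hx⟩
  rw [dist_zero_right, norm_smul, Real.norm_of_nonneg (by positivity), div_mul_eq_mul_div,
    div_lt_iff₀ (by positivity)]
  gcongr
  linarith

end LevelSets

/-! ### The excited state inside the ionized subspace -/

section Ionization

variable {A : Hil →ₗ.[ℂ] Hil} {E : ℝ}

theorem isSelfAdjointOperator_of_mem_discreteSpectrum (hA : A.IsFormalAdjoint A)
    (hE : E ∈ discreteSpectrum A) : IsSelfAdjointOperator A := by
  obtain ⟨-, -, δ, hδ, hres⟩ := hE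
  have hmem : ((E + δ / 2 : ℝ) : ℂ) ∈ resolventSet A := by
    refine hres _ (fun h => ?_) ?_
    · linarith [Complex.ofReal_injective h]
    · rw [← Complex.ofReal_sub, add_sub_cancel_left, Complex.norm_of_nonneg (by positivity)]
      exact half_lt_self hδ
  obtain ⟨R, hR⟩ := mem_resolventSet_iff.mp hmem
  exact hR.isSelfAdjointOperator hA

theorem not_ae_essProj_coupling_eq_zero (hdisc : discreteSpectrum A = {E})
    (hsimple : Module.finrank ℂ (eigenspace A E) = 1) {φ : Hil} (hφ : φ ∈ eigenspace A E)
    (hφ1 : ‖φ‖ = 1) {χ : 𝓢(Space, ℂ)} {c : ℂ} (hc : c ≠ 0) {α : ℝ}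
    (hS : volume {x | χ (α • x) = c ∧ φ x ≠ 0} ≠ 0) {κ : ℝ → ℂ}
    (hκ : ¬ κ =ᵐ[volume.restrict (Ioi 0)] 0) :
    ¬ ∀ᵐ k ∂modeMeasure, essProj A (coupling κ χ α k φ) = 0 := by
  intro hzero
  refine hκ (ae_restrict_of_ae_modeMeasure ?_)
  filter_upwards [ae_modeMeasure_pos, hzero] with k hk hk_zero
  rw [essProj_apply_eq_zero_iff hdisc, eigenProj_apply hsimple hφ hφ1] at hk_zero
  by_contra hκk
  exact coupling_apply_ne_smul hc hS hk hκk _ hk_zero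

end Ionization

end ThermalIonization

end

open ThermalIonization ComplexOrder in
theorem mainTheorem3_general (A : Hil →ₗ.[ℂ] Hil) (hA : A.IsFormalAdjoint A) (E : ℝ)
    (hdisc : discreteSpectrum A = {E}) (hsimple : Module.finrank ℂ (eigenspace A E) = 1)
    (χ : 𝓢(Space, ℂ)) (c : ℂ) (hc : c ≠ 0) (hχ : ∀ᶠ x in 𝓝 (0 : Space), χ x = c)
    (κ : ℝ → ℂ) (hκm : AEStronglyMeasurable κ (volume.restrict (Ioi 0)))
    (hκi : IntegrableOn (fun ω => (ω ^ 2 + ω) * ‖κ ω‖ ^ 2) (Ioi 0))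
    (hκ : ¬ κ =ᵐ[volume.restrict (Ioi 0)] 0) (ε : ℝ) (hε : 0 < ε) :
    ∃ α : ℝ, 0 < α ∧ ∃ γ : ℝ, 0 < γ ∧ ∀ β : ℝ, 0 < β →
      let G := coupling κ χ α
      let p := eigenProj A E
      let F := levelShiftTwo A G β ε E
      Integrable (integrandTwo A G β ε E) modeMeasure ∧
      (γ : ℂ) • p ≤ p ∘L F ∘L p ∧
      (∀ φ ∈ eigenspace A E, ‖φ‖ = 1 → p ∘L F ∘L p = ⟪φ, F φ⟫_ℂ • p) ∧
      FermiGoldenRule A G β ε γ := by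
  have hself := isSelfAdjointOperator_of_mem_discreteSpectrum hA (hdisc ▸ mem_singleton E)
  obtain ⟨φ, hφ1, hφ⟩ := exists_norm_eq_one_of_finrank_eq_one hsimple
  obtain ⟨α, hα, hS⟩ := exists_scale hχ (norm_ne_zero_iff.mp (hφ1 ▸ one_ne_zero))
  obtain ⟨ρ, hρ, hGρ⟩ := exists_norm_coupling_le χ α hκi
  have hG := aestronglyMeasurable_coupling χ hα.ne' hκm
  have hpos := hself.inner_spontaneousEmission_pos (E := E) hε hρ hG hGρ
    (not_ae_essProj_coupling_eq_zero hdisc hsimple hφ hφ1 hc hS hκ)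
  obtain ⟨γ, hγ, hγφ : (γ : ℂ) = _⟩ := RCLike.pos_iff_exists_ofReal.mp hpos
  refine ⟨α, hα, γ, hγ, fun β hβ => ?_⟩
  intro G p F
  have hF : Integrable (integrandTwo A G β ε E) modeMeasure :=
    hself.integrable_integrandTwo hβ hε hρ hG hGρ
  have hlower : (γ : ℂ) • p ≤ p ∘L F ∘L p := by
    rw [hγφ, ← eigenProj_comp_comp_eigenProj hsimple hφ hφ1]
    exact eigenProj_comp_comp_mono (hself.spontaneousEmission_le_levelShiftTwo hβ hε hρ hG hGρ)
  refine ⟨hF, hlower, fun ψ hψ hψ1 => eigenProj_comp_comp_eigenProj hsimple hψ hψ1 F,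
    hγ, fun E' hE' => ?_⟩
  obtain rfl : E' = E := by rwa [hdisc] at hE'
  have hle : F ≤ levelShiftOne A G β ε E' + F :=
    le_add_of_nonneg_left (hself.levelShiftOne_nonneg hβ hε)
  exact ⟨hself.integrable_integrandOne hβ hε hρ hG hGρ, hF,
    hlower.trans (eigenProj_comp_comp_mono hle)⟩

theorem mainTheorem3
    -- the potential: smooth, compactly supported, nonpositive
    (V : ThermalIonization.Space → ℝ) (hV : ContDiff ℝ ((⊤ : ℕ∞) : WithTop ℕ∞) V) (hVc : HasCompactSupport V)
    (hV0 : ∀ x, V x ≤ 0)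
    -- `-Δ + V` has exactly one discrete eigenvalue, which is negative and non-degenerate,
    -- and zero is not an eigenvalue
    (E : ℝ) (hE : E < 0)
    (hdisc : ThermalIonization.discreteSpectrum (ThermalIonization.schrodinger V) = {E})
    (hsimple :
      Module.finrank ℂ (ThermalIonization.eigenspace (ThermalIonization.schrodinger V) E) = 1)
    (hzero : ThermalIonization.eigenspace (ThermalIonization.schrodinger V) 0 = ⊥)
    -- the spatial cutoff: Schwartz, constant and nonzero near the origin
    (χ : 𝓢(ThermalIonization.Space, ℂ)) (c : ℂ) (hc : c ≠ 0)
    (hχ : ∀ᶠ x in 𝓝 (0 : ThermalIonization.Space), χ x = c)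
    -- the form factor, not identically zero
    (κ : ℝ → ℂ) (hUV : ThermalIonization.UVCutoff κ)
    (hIR : ThermalIonization.InfraredBehavior κ) (hκ : ∃ ω : ℝ, 0 < ω ∧ κ ω ≠ 0)
    (ε : ℝ) (hε : 0 < ε) :
    ∃ α : ℝ, 0 < α ∧ ∃ γ : ℝ, 0 < γ ∧ ∀ β : ℝ, 0 < β →
      let H := ThermalIonization.schrodinger V
      let G := ThermalIonization.coupling κ χ α
      let p := ThermalIonization.eigenProj H E
      let F := ThermalIonization.levelShiftTwo H G β ε E
      Integrable (ThermalIonization.integrandTwo H G β ε E) ThermalIonization.modeMeasure ∧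
      (γ : ℂ) • p ≤ p ∘L F ∘L p ∧
      (∀ φ ∈ ThermalIonization.eigenspace H E, ‖φ‖ = 1 → p ∘L F ∘L p = ⟪φ, F φ⟫_ℂ • p) ∧
      ThermalIonization.FermiGoldenRule H G β ε γ := by
  exact mainTheorem3_general _ (ThermalIonization.schrodinger_isFormalAdjoint V) E hdisc hsimple
    χ c hc hχ κ hIR.aestronglyMeasurable (ThermalIonization.integrableOn_formFactor hUV hIR)
    (hIR.not_ae_eq_zero hκ) ε hε
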